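/- Let $(X_{1,j})_{j\ge 1}$ and $(X_{2,j})_{j\ge 1}$ be two sequences of real random variables on a common probability space such that, for $i=1,2$, the sequence $(X_{i,j})_{j\ge1}$ is independent and identically distributed and square integrable, with mean $\mu_i$ and variance $\sigma_i^2$, where $\sigma_i>0$. Assume that the random vectors $(X_{1,j},X_{2,j})$, $j\ge1$, are independent across $j$ (they need not be identically distributed, and the two coordinates of a vector may be dependent). Let $\rho_{jj}$ be the correlation coefficient of $X_{1,j}$ and $X_{2,j}$, let $\bar X_{i,n}=\frac1n\sum_{j=1}^n X_{i,j}$, and for positive integers $n_1,n_2$ let $$\bar\rho_{n_1,n_2}=\frac1{\sqrt{n_1n_2}}\sum_{j=1}^{\min(n_1,n_2)}\rho_{jj}.$$ Limits as $n_1,n_2\to\infty$ are limits of nets indexed by $\mathbb N\times\mathbb N$ with the coordinatewise order. Then the following four conditions are equivalent. (17) $\bar\rho_{n_1,n_2}\to0$ as $n_1,n_2\to\infty$. (18) $\bar\rho_{k,k}=\frac1k\sum_{j=1}^k\rho_{jj}\to0$ as $k\to\infty$. (9) As $n_1,n_2\to\infty$, the random vectors $$\left(\frac{\sqrt{n_1}\,(\bar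 X_{1,n_1}-\mu_1)}{\sigma_1},\ \frac{\sqrt{n_2}\,(\bar X_{2,n_2}-\mu_2)}{\sigma_2}\right)$$ converge in distribution to the standard bivariate normal distribution $N(0,1)\times N(0,1)$. (19) As $n_1,n_2\to\infty$, the random variables $$\frac{(\bar X_{1,n_1}-\mu_1)-(\bar X_{2,n_2}-\mu_2)}{\sqrt{\sigma_1^2/n_1+\sigma_2^2/n_2}}$$ converge in distribution to $N(0,1)$. -/

import Mathlib

open MeasureTheory ProbabilityTheory Filter Topology

noncomputable section

namespace SampleMeans

variable {Ω : Type*} [MeasurableSpace Ω]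

/-- `X 0, X 1, …` is a sequence of independent, identically distributed, square integrable real
random variables on `(Ω, P)`, with mean `m` and variance `s ^ 2`, where `s > 0`. -/
structure IsIIDSeq (P : Measure Ω) (X : ℕ → Ω → ℝ) (m s : ℝ) : Prop where
  measurable : ∀ j, Measurable (X j)
  indep : iIndepFun X P
  identDistrib : ∀ j k, IdentDistrib (X j) (X k) P P
  memLp_two : ∀ j, MemLp (X j) 2 P
  mean_eq : ∀ j, ∫ ω, X j ω ∂P = m
  variance_eq : ∀ j, variance (X j) P = s ^ 2
  sd_pos : 0 < s

/-- The sample mean of the first `n` terms of the sequence. -/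
def sampleMean (X : ℕ → Ω → ℝ) (n : ℕ) (ω : Ω) : ℝ :=
  (∑ j ∈ Finset.range n, X j ω) / n

/-- The standardized sample mean `√n (X̄ₙ - m) / s`. -/
def standardizedMean (X : ℕ → Ω → ℝ) (m s : ℝ) (n : ℕ) (ω : Ω) : ℝ :=
  √(n : ℝ) * (sampleMean X n ω - m) / s

/-- The standardized difference of the two sample means, based on `n₁` and `n₂` observations. -/
def standardizedDiff (X₁ X₂ : ℕ → Ω → ℝ) (m₁ m₂ s₁ s₂ : ℝ) (n₁ n₂ : ℕ) (ω : Ω) : ℝ :=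
  ((sampleMean X₁ n₁ ω - m₁) - (sampleMean X₂ n₂ ω - m₂)) / √(s₁ ^ 2 / n₁ + s₂ ^ 2 / n₂)

/-- The correlation coefficient of two real random variables. -/
def correlation (P : Measure Ω) (U V : Ω → ℝ) : ℝ :=
  covariance U V P / (√(variance U P) * √(variance V P))

/-- The net of normalized sums of cross correlations, indexed by pairs `α = (n₁, n₂)`. -/
def rhoBar (P : Measure Ω) (X₁ X₂ : ℕ → Ω → ℝ) (α : ℕ × ℕ) : ℝ :=
  1 / √((α.1 : ℝ) * (α.2 : ℝ)) *
    ∑ j ∈ Finset.range (min α.1 α.2), correlation P (X₁ j) (X₂ j)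

end SampleMeans

end

/-! Standardize the variables to `U j`, `V j`. Any combination `a S + b T` of the two normalized
sums is a single sum over `j < max n₁ n₂` of independent centered terms, one per pair, and its
variance is exactly `a² + b² + 2ab · rhoBar`. Lindeberg's argument
(`norm_integral_exp_sub_gaussian_pair_le`) shows that its characteristic function differs from that
of the Gaussian with this variance by a quantity tending to zero, whatever `rhoBar` does and
uniformly over bounded `a`, `b`, which may vary with `(n₁, n₂)`. This is
`tendsto_integral_exp_standardizedMean_sub`; everything else is read off from it.

If `rhoBar → 0`, the cross term vanishes in the limit and Lévy's theorem gives both convergences: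
the joint one with constant `a`, `b`, the one for the difference with weights whose squares sum to
one. Conversely, a single frequency recovers `rhoBar` from the exponent: `a = b = 1` in the joint
case, and in the difference case the diagonal `n₁ = n₂`, where the weights are constant and nonzero.
The diagonal controls the whole net by `abs_rhoBar_le`. -/

namespace SampleMeans

/-! ### Taylor estimates and the Lindeberg bound for finite sums -/

/-- The truncated second moment integrand `min (x², |x|³)`. -/
noncomputable def minSqCube (x : ℝ) : ℝ := min (x ^ 2) (|x| ^ 3)

lemma minSqCube_nonneg (x : ℝ) : 0 ≤ minSqCube x := by unfold minSqCube; positivity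

lemma minSqCube_le_sq (x : ℝ) : minSqCube x ≤ x ^ 2 := min_le_left _ _

lemma measurable_minSqCube : Measurable minSqCube := by unfold minSqCube; fun_prop

lemma minSqCube_zero : minSqCube 0 = 0 := by simp [minSqCube]

lemma minSqCube_mono {x y : ℝ} (h : |x| ≤ |y|) : minSqCube x ≤ minSqCube y := by
  unfold minSqCube
  rw [← sq_abs x, ← sq_abs y]
  gcongr

lemma minSqCube_two_mul_le (x : ℝ) : minSqCube (2 * x) ≤ 8 * minSqCube x := by
  unfold minSqCube
  rw [abs_mul, abs_two, mul_pow, mul_pow]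
  rw [mul_min_of_nonneg _ _ (by norm_num : (0 : ℝ) ≤ 8)]
  apply min_le_min
  · nlinarith [sq_nonneg x]
  · norm_num

/-- The sum is at most twice the larger of the two in absolute value, and doubling costs a factor `2
^ 3`. This separates the contributions of the two coordinates without using their joint law. -/
lemma minSqCube_add_le (x y : ℝ) :
    minSqCube (x + y) ≤ 8 * (minSqCube x + minSqCube y) := by
  have hx := minSqCube_nonneg x
  have hy := minSqCube_nonneg y
  rcases le_total |x| |y| with h | h
  · calc minSqCube (x + y) ≤ minSqCube (2 * y) := by
          apply minSqCube_mono
          rw [abs_mul, abs_two]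
          linarith [abs_add_le x y]
      _ ≤ 8 * minSqCube y := minSqCube_two_mul_le y
      _ ≤ _ := by linarith
  · calc minSqCube (x + y) ≤ minSqCube (2 * x) := by
          apply minSqCube_mono
          rw [abs_mul, abs_two]
          linarith [abs_add_le x y]
      _ ≤ 8 * minSqCube x := minSqCube_two_mul_le x
      _ ≤ _ := by linarith

/-- For `|y| ≤ 1` the cubic Taylor remainder applies; for `|y| ≥ 1` each term is bounded separately
and `y ^ 2` dominates. -/
lemma norm_exp_mul_I_sub_taylor_le (y : ℝ) :
    ‖Complex.exp (y * Complex.I) - (1 + y * Complex.I - y ^ 2 / 2)‖ ≤ 4 * minSqCube y := by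
  rcases le_total |y| 1 with h | h
  · have hn : ‖(y : ℂ) * Complex.I‖ = |y| := by simp
    have h1 := Complex.exp_bound (x := y * Complex.I) (by rw [hn]; exact h) (n := 3) (by norm_num)
    rw [hn] at h1
    have h2 : ∑ m ∈ Finset.range 3, ((y : ℂ) * Complex.I) ^ m / m.factorial
        = 1 + y * Complex.I - y ^ 2 / 2 := by
      simp [Finset.sum_range_succ, mul_pow]
      ring
    rw [h2] at h1
    have h3 : minSqCube y = |y| ^ 3 := by
      unfold minSqCube
      rw [← sq_abs, min_eq_right (pow_le_pow_of_le_one (abs_nonneg y) h (by norm_num))]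
    rw [h3]
    refine h1.trans ?_
    norm_num [Nat.factorial]
    nlinarith [pow_nonneg (abs_nonneg y) 3]
  · have h3 : minSqCube y = |y| ^ 2 := by
      unfold minSqCube
      rw [← sq_abs, min_eq_left (pow_le_pow_right₀ h (by norm_num))]
    rw [h3]
    have h4 : ‖(y : ℂ) ^ 2 / 2‖ = |y| ^ 2 / 2 := by simp
    have h5 : ‖(y : ℂ) * Complex.I‖ = |y| := by simp
    calc _ ≤ ‖Complex.exp (y * Complex.I)‖ + (‖(1 : ℂ)‖ + ‖(y : ℂ) * Complex.I‖
            + ‖(y : ℂ) ^ 2 / 2‖) := by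
          refine (norm_sub_le _ _).trans ?_
          gcongr
          refine (norm_sub_le _ _).trans ?_
          gcongr
          exact norm_add_le _ _
      _ = 2 + |y| + |y| ^ 2 / 2 := by
          rw [Complex.norm_exp_ofReal_mul_I, h4, h5, norm_one]; ring
      _ ≤ _ := by nlinarith

lemma abs_exp_neg_sub_le {x : ℝ} (hx : 0 ≤ x) : |Real.exp (-x) - (1 - x)| ≤ x ^ 2 / 2 := by
  have h1 := Real.add_one_le_exp (-x)
  have h2 := Real.quadratic_le_exp_of_nonneg hx
  have h3 : Real.exp (-x) * Real.exp x = 1 := by rw [← Real.exp_add]; simp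
  have h4 := Real.exp_pos (-x)
  rw [abs_of_nonneg (by linarith)]
  have h5 : Real.exp (-x) * (1 + x + x ^ 2 / 2) ≤ 1 := by
    calc _ ≤ Real.exp (-x) * Real.exp x := by gcongr
      _ = 1 := h3
  have h6 : 0 < 1 + x + x ^ 2 / 2 := by positivity
  -- The product on the right equals `1 + x ^ 4 / 4`.
  have h7 : Real.exp (-x) * (1 + x + x ^ 2 / 2)
      ≤ (1 - x + x ^ 2 / 2) * (1 + x + x ^ 2 / 2) := by nlinarith [sq_nonneg (x ^ 2)]
  linarith [le_of_mul_le_mul_right h7 h6]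

/-- Factors are exchanged one at a time; all the others have norm at most one. -/
lemma norm_prod_sub_prod_le {ι : Type*} (s : Finset ι) (f g : ι → ℂ)
    (hf : ∀ i, ‖f i‖ ≤ 1) (hg : ∀ i, ‖g i‖ ≤ 1) :
    ‖∏ i ∈ s, f i - ∏ i ∈ s, g i‖ ≤ ∑ i ∈ s, ‖f i - g i‖ := by
  classical
  induction s using Finset.induction_on with
  | empty => simp
  | insert a s ha ih =>
    rw [Finset.prod_insert ha, Finset.prod_insert ha, Finset.sum_insert ha]
    have hF : ‖∏ i ∈ s, f i‖ ≤ 1 := by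
      rw [norm_prod]; exact Finset.prod_le_one (fun _ _ => norm_nonneg _) fun i _ => hf i
    calc _ = ‖(f a - g a) * ∏ i ∈ s, f i + g a * (∏ i ∈ s, f i - ∏ i ∈ s, g i)‖ := by
          congr 1; ring
      _ ≤ ‖f a - g a‖ * 1 + 1 * ‖∏ i ∈ s, f i - ∏ i ∈ s, g i‖ := by
          refine (norm_add_le _ _).trans ?_
          rw [norm_mul, norm_mul]
          gcongr
          exact hg a
      _ ≤ _ := by linarith

variable {Ω : Type*} [MeasurableSpace Ω] {P : Measure Ω}

lemma integrable_minSqCube {Y : Ω → ℝ} (hm : Measurable Y) (hY : MemLp Y 2 P) :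
    Integrable (fun ω => minSqCube (Y ω)) P := by
  refine hY.integrable_sq.mono' (measurable_minSqCube.comp hm).aestronglyMeasurable ?_
  refine ae_of_all _ fun ω => ?_
  rw [Real.norm_of_nonneg (minSqCube_nonneg _)]
  exact minSqCube_le_sq _

variable [IsProbabilityMeasure P]

lemma integrable_exp_mul_I {Y : Ω → ℝ} (hY : Measurable Y) :
    Integrable (fun ω => Complex.exp (Y ω * Complex.I)) P :=
  Integrable.of_bound (by fun_prop) 1 (ae_of_all _ fun ω => by
    rw [Complex.norm_exp_ofReal_mul_I])

lemma norm_integral_exp_mul_I_le_one (Y : Ω → ℝ) :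
    ‖∫ ω, Complex.exp (Y ω * Complex.I) ∂P‖ ≤ 1 := by
  refine (norm_integral_le_integral_norm _).trans ?_
  simp [Complex.norm_exp_ofReal_mul_I]

/-- Taylor bound for the characteristic function of a centered random variable, compared with the
Gaussian of the same variance. -/
lemma norm_integral_exp_sub_gaussian_le {Y : Ω → ℝ} (hm : Measurable Y) (hY : MemLp Y 2 P)
    (h0 : ∫ ω, Y ω ∂P = 0) :
    ‖∫ ω, Complex.exp (Y ω * Complex.I) ∂P - Real.exp (-((∫ ω, Y ω ^ 2 ∂P) / 2))‖
      ≤ 4 * ∫ ω, minSqCube (Y ω) ∂P + (∫ ω, Y ω ^ 2 ∂P) ^ 2 := by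
  set c := ∫ ω, Y ω ^ 2 ∂P with hc
  have hc0 : 0 ≤ c := integral_nonneg fun ω => sq_nonneg _
  have hi1 : Integrable Y P := hY.integrable (by norm_num)
  have hi2 : Integrable (fun ω => Y ω ^ 2) P := hY.integrable_sq
  have hI1 : Integrable (fun ω => (Y ω : ℂ) * Complex.I) P := hi1.ofReal.mul_const _
  have hI2 : Integrable (fun ω => (Y ω : ℂ) ^ 2 / 2) P := by
    have := (hi2.ofReal (𝕜 := ℂ)).div_const 2
    simpa using this
  have hI3 : Integrable (fun ω => (1 : ℂ) + Y ω * Complex.I) P := (integrable_const _).add hI1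
  have hT : ∫ ω, ((1 : ℂ) + Y ω * Complex.I - (Y ω : ℂ) ^ 2 / 2) ∂P = (1 : ℂ) - (c : ℂ) / 2 := by
    rw [integral_sub hI3 hI2, integral_add (integrable_const _) hI1,
      integral_mul_const, integral_complex_ofReal, h0, integral_div]
    have : ∫ ω, (Y ω : ℂ) ^ 2 ∂P = (c : ℂ) := by
      rw [hc, ← integral_complex_ofReal]; simp
    rw [this]; simp
  have hI4 : Integrable (fun ω => (1 : ℂ) + Y ω * Complex.I - (Y ω : ℂ) ^ 2 / 2) P := hI3.sub hI2
  -- The pivot `1 - c / 2` is the low-order expansion of both characteristic functions.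
  have hA : ‖∫ ω, Complex.exp (Y ω * Complex.I) ∂P - (1 - c / 2)‖
      ≤ 4 * ∫ ω, minSqCube (Y ω) ∂P := by
    rw [← hT, ← integral_sub (integrable_exp_mul_I hm) hI4,
      ← integral_const_mul]
    exact norm_integral_le_of_norm_le ((integrable_minSqCube hm hY).const_mul 4)
      (ae_of_all _ fun ω => norm_exp_mul_I_sub_taylor_le (Y ω))
  have hB : ‖((1 : ℂ) - c / 2) - Real.exp (-(c / 2))‖ ≤ c ^ 2 := by
    have h := abs_exp_neg_sub_le (x := c / 2) (by positivity)
    have : ((1 : ℂ) - c / 2) - Real.exp (-(c / 2))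
        = ((1 - c / 2 - Real.exp (-(c / 2)) : ℝ) : ℂ) := by push_cast; ring
    rw [this, Complex.norm_real, Real.norm_eq_abs, abs_sub_comm]
    refine h.trans ?_
    nlinarith [sq_nonneg c]
  calc _ ≤ _ := norm_sub_le_norm_sub_add_norm_sub _ ((1 : ℂ) - c / 2) _
    _ ≤ _ := add_le_add hA hB

/-- Quantitative Lindeberg estimate for a finite sum of independent centered variables. -/
lemma norm_integral_exp_sum_sub_gaussian_le {Y : ℕ → Ω → ℝ} (hm : ∀ j, Measurable (Y j))
    (hY : ∀ j, MemLp (Y j) 2 P) (h0 : ∀ j, ∫ ω, Y j ω ∂P = 0) (hind : iIndepFun Y P)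
    (s : Finset ℕ) :
    ‖∫ ω, Complex.exp ((∑ j ∈ s, Y j ω : ℝ) * Complex.I) ∂P
        - Real.exp (-((∑ j ∈ s, ∫ ω, Y j ω ^ 2 ∂P) / 2))‖
      ≤ ∑ j ∈ s, (4 * ∫ ω, minSqCube (Y j ω) ∂P + (∫ ω, Y j ω ^ 2 ∂P) ^ 2) := by
  have hchar : ∀ Z : Ω → ℝ, Measurable Z →
      charFun (P.map Z) 1 = ∫ ω, Complex.exp (Z ω * Complex.I) ∂P := by
    intro Z hZ
    rw [charFun_apply_real, integral_map hZ.aemeasurable (by fun_prop)]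
    simp
  have hprod : ∫ ω, Complex.exp ((∑ j ∈ s, Y j ω : ℝ) * Complex.I) ∂P
      = ∏ j ∈ s, ∫ ω, Complex.exp (Y j ω * Complex.I) ∂P := by
    rw [← hchar (fun ω => ∑ j ∈ s, Y j ω) (by fun_prop),
      (hind.restrict _).charFun_map_fun_finsetSum_eq_prod (fun j _ => (hm j).aemeasurable),
      Finset.prod_apply]
    exact Finset.prod_congr rfl fun j _ => hchar _ (hm j)
  have hexp : ((Real.exp (-((∑ j ∈ s, ∫ ω, Y j ω ^ 2 ∂P) / 2)) : ℝ) : ℂ)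
      = ∏ j ∈ s, ((Real.exp (-((∫ ω, Y j ω ^ 2 ∂P) / 2)) : ℝ) : ℂ) := by
    rw [← Complex.ofReal_prod, ← Real.exp_sum, Finset.sum_neg_distrib, Finset.sum_div]
  rw [hprod, hexp]
  refine (norm_prod_sub_prod_le s _ _ (fun j => norm_integral_exp_mul_I_le_one _)
    (fun j => ?_)).trans
    (Finset.sum_le_sum fun j _ => norm_integral_exp_sub_gaussian_le (hm j) (hY j) (h0 j))
  rw [Complex.norm_real, Real.norm_of_nonneg (Real.exp_pos _).le, Real.exp_le_one_iff]
  have : 0 ≤ ∫ ω, Y j ω ^ 2 ∂P := integral_nonneg fun ω => sq_nonneg _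
  linarith

end SampleMeans

/-! ### Lindeberg rates and the bound for a pair of normalized sums -/

namespace SampleMeans

variable {Ω : Type*} [MeasurableSpace Ω] {P : Measure Ω}

/-- A sequence of identically distributed random variables with mean `0` and variance `1`. -/
structure IsStandardSeq (P : Measure Ω) (U : ℕ → Ω → ℝ) : Prop where
  measurable : ∀ j, Measurable (U j)
  identDistrib : ∀ j, IdentDistrib (U j) (U 0) P P
  memLp_two : ∀ j, MemLp (U j) 2 P
  mean_eq : ∀ j, ∫ ω, U j ω ∂P = 0
  sq_mean_eq : ∀ j, ∫ ω, U j ω ^ 2 ∂P = 1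

/-- The Lindeberg functional of `n` copies of `U`, scaled by `M / √n`. -/
noncomputable def lindebergRate (P : Measure Ω) (U : Ω → ℝ) (M : ℝ) (n : ℕ) : ℝ :=
  n * ∫ ω, minSqCube (M / √n * U ω) ∂P

/-- Dominated convergence, using both branches of the minimum: the square gives the integrable bound
`M² U²`, the cube gives pointwise decay of order `1 / √n`. -/
lemma tendsto_lindebergRate {U : Ω → ℝ} (hm : Measurable U) (hU : MemLp U 2 P) (M : ℝ) :
    Tendsto (lindebergRate P U M) atTop (𝓝 0) := by
  unfold lindebergRate
  simp_rw [← integral_const_mul]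
  have hlim : Tendsto (fun n : ℕ => ∫ ω, (n : ℝ) * minSqCube (M / √n * U ω) ∂P) atTop
      (𝓝 (∫ _, (0 : ℝ) ∂P)) := by
    refine tendsto_integral_of_dominated_convergence (fun ω => M ^ 2 * U ω ^ 2) ?_ ?_ ?_ ?_
    · intro n
      exact ((measurable_minSqCube.comp (hm.const_mul _)).const_mul _).aestronglyMeasurable
    · exact hU.integrable_sq.const_mul _
    · refine fun n => ae_of_all _ fun ω => ?_
      rw [Real.norm_of_nonneg (mul_nonneg n.cast_nonneg (minSqCube_nonneg _))]
      rcases n.eq_zero_or_pos with rfl | hn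
      · simp; positivity
      · have hn' : (0 : ℝ) < n := by exact_mod_cast hn
        calc _ ≤ (n : ℝ) * (M / √n * U ω) ^ 2 := by gcongr; exact minSqCube_le_sq _
          _ = M ^ 2 * U ω ^ 2 := by
            rw [mul_pow, div_pow, Real.sq_sqrt hn'.le]; field_simp
    · refine ae_of_all _ fun ω => ?_
      have hz : Tendsto (fun n : ℕ => |M * U ω| ^ 3 * (√(n : ℝ))⁻¹) atTop (𝓝 0) := by
        rw [← mul_zero (|M * U ω| ^ 3)]
        exact (tendsto_inv_atTop_zero.comp <| Real.tendsto_sqrt_atTop.comp <|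
          tendsto_natCast_atTop_atTop).const_mul _
      refine squeeze_zero' (Eventually.of_forall fun n =>
        mul_nonneg n.cast_nonneg (minSqCube_nonneg _)) ?_ hz
      filter_upwards [eventually_gt_atTop 0] with n hn
      have hn' : (0 : ℝ) < n := by exact_mod_cast hn
      have hs : 0 < √(n : ℝ) := Real.sqrt_pos.2 hn'
      have hq : (n : ℝ) = √(n : ℝ) ^ 2 := (Real.sq_sqrt hn'.le).symm
      calc (n : ℝ) * minSqCube (M / √n * U ω) ≤ n * |M / √n * U ω| ^ 3 := by
            gcongr; exact min_le_right _ _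
        _ = √(n : ℝ) ^ 2 * |M / √n * U ω| ^ 3 := by rw [← hq]
        _ = |M * U ω| ^ 3 * (√(n : ℝ))⁻¹ := by
            rw [show M / √(n : ℝ) * U ω = (M * U ω) / √n by ring, abs_div, abs_of_pos hs]
            field_simp
  simpa using hlim

lemma sum_range_ite_lt {n N : ℕ} (h : n ≤ N) (f : ℕ → ℝ) :
    ∑ j ∈ Finset.range N, (if j < n then f j else 0) = ∑ j ∈ Finset.range n, f j := by
  rw [← Finset.sum_filter]
  congr 1
  ext j
  simp only [Finset.mem_filter, Finset.mem_range]
  omega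

/-- Equality in law replaces each `U j` by `U 0`, so the bound depends on `n` and `M` only, not on
the padding up to `N`. -/
lemma IsStandardSeq.sum_integral_minSqCube_le {U : ℕ → Ω → ℝ} (hU : IsStandardSeq P U)
    {n N : ℕ} (h : n ≤ N) {a M : ℝ} (ha : |a| ≤ M) :
    ∑ j ∈ Finset.range N, ∫ ω, minSqCube ((if j < n then a / √n else 0) * U j ω) ∂P
      ≤ lindebergRate P (U 0) M n := by
  have hterm : ∀ j, ∫ ω, minSqCube ((if j < n then a / √n else 0) * U j ω) ∂P
      ≤ if j < n then ∫ ω, minSqCube (M / √n * U 0 ω) ∂P else 0 := by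
    intro j
    split_ifs with hj
    · have h1 : ∫ ω, minSqCube (M / √n * U 0 ω) ∂P = ∫ ω, minSqCube (M / √n * U j ω) ∂P :=
        ((hU.identDistrib j).comp
          (measurable_minSqCube.comp (measurable_const_mul (M / √(n : ℝ))))).integral_eq.symm
      rw [h1]
      refine integral_mono
        (integrable_minSqCube ((hU.measurable j).const_mul _) ((hU.memLp_two j).const_mul _))
        (integrable_minSqCube ((hU.measurable j).const_mul _) ((hU.memLp_two j).const_mul _))
        fun ω => minSqCube_mono ?_
      rw [abs_mul, abs_mul, abs_div, abs_div]
      exact mul_le_mul_of_nonneg_right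
        (div_le_div_of_nonneg_right (ha.trans (le_abs_self M)) (abs_nonneg _)) (abs_nonneg _)
    · simp [minSqCube_zero]
  refine (Finset.sum_le_sum fun j _ => hterm j).trans_eq ?_
  rw [sum_range_ite_lt h, Finset.sum_const, Finset.card_range, nsmul_eq_mul, lindebergRate]

lemma sum_range_ite_pow_four_le {n N : ℕ} (hn : 0 < n) (h : n ≤ N) {a M : ℝ} (ha : |a| ≤ M) :
    ∑ j ∈ Finset.range N, (if j < n then a / √n else 0 : ℝ) ^ 4 ≤ M ^ 4 / n := by
  have hn' : (0 : ℝ) < n := by exact_mod_cast hn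
  have h1 : ∀ j : ℕ, (if j < n then a / √(n : ℝ) else 0 : ℝ) ^ 4
      = if j < n then (a / √(n : ℝ)) ^ 4 else 0 := by
    intro j; split_ifs <;> simp
  simp_rw [h1]
  rw [sum_range_ite_lt h, Finset.sum_const, Finset.card_range, nsmul_eq_mul, div_pow]
  have h2 : √(n : ℝ) ^ 4 = (n : ℝ) ^ 2 := by
    rw [show √(n : ℝ) ^ 4 = (√(n : ℝ) ^ 2) ^ 2 by ring, Real.sq_sqrt hn'.le]
  have h3 : a ^ 4 ≤ M ^ 4 := by
    rw [← Even.pow_abs (by decide : Even 4)]; gcongr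
  rw [h2]
  calc (n : ℝ) * (a ^ 4 / n ^ 2) = a ^ 4 / n := by field_simp
    _ ≤ _ := by gcongr

variable [IsProbabilityMeasure P]

/-- The characteristic function of a linear combination of two normalized sums, compared with
that of the Gaussian with the same covariance. -/
lemma norm_integral_exp_sub_gaussian_pair_le {U V : ℕ → Ω → ℝ} (hU : IsStandardSeq P U)
    (hV : IsStandardSeq P V) (hind : iIndepFun (fun j ω => (U j ω, V j ω)) P) {n₁ n₂ : ℕ}
    (h₁ : 0 < n₁) (h₂ : 0 < n₂) {a b M : ℝ} (ha : |a| ≤ M) (hb : |b| ≤ M) :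
    ‖∫ ω, Complex.exp ((a * ((√n₁)⁻¹ * ∑ j ∈ Finset.range n₁, U j ω)
        + b * ((√n₂)⁻¹ * ∑ j ∈ Finset.range n₂, V j ω) : ℝ) * Complex.I) ∂P
      - Real.exp (-((a ^ 2 + b ^ 2 + 2 * a * b * (1 / √((n₁ : ℝ) * n₂) *
        ∑ j ∈ Finset.range (min n₁ n₂), ∫ ω, U j ω * V j ω ∂P)) / 2))‖
      ≤ 32 * (lindebergRate P (U 0) M n₁ + lindebergRate P (V 0) M n₂)
        + 8 * (M ^ 4 / n₁ + M ^ 4 / n₂) := by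
  have h₁' : (0 : ℝ) < n₁ := by exact_mod_cast h₁
  have h₂' : (0 : ℝ) < n₂ := by exact_mod_cast h₂
  -- Padding the coefficients with zeros puts both sums on one index range, so that only
  -- independence across `j` is needed.
  set N := max n₁ n₂ with hN
  set x : ℕ → ℝ := fun j => if j < n₁ then a / √n₁ else 0 with hx
  set y : ℕ → ℝ := fun j => if j < n₂ then b / √n₂ else 0 with hy
  set Y : ℕ → Ω → ℝ := fun j ω => x j * U j ω + y j * V j ω with hYdef
  have hYm : ∀ j, Measurable (Y j) := fun j =>
    ((hU.measurable j).const_mul _).add ((hV.measurable j).const_mul _)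
  have hxU : ∀ j, MemLp (fun ω => x j * U j ω) 2 P := fun j => (hU.memLp_two j).const_mul _
  have hyV : ∀ j, MemLp (fun ω => y j * V j ω) 2 P := fun j => (hV.memLp_two j).const_mul _
  have hYL : ∀ j, MemLp (Y j) 2 P := fun j => (hxU j).add (hyV j)
  have hY0 : ∀ j, ∫ ω, Y j ω ∂P = 0 := by
    intro j
    rw [hYdef]
    simp only
    rw [integral_add ((hxU j).integrable (by norm_num)) ((hyV j).integrable (by norm_num)),
      integral_const_mul, integral_const_mul, hU.mean_eq, hV.mean_eq]
    simp
  have hYind : iIndepFun Y P :=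
    hind.comp (fun j (p : ℝ × ℝ) => x j * p.1 + y j * p.2) (fun j => by fun_prop)
  have hYsq : ∀ j, ∫ ω, Y j ω ^ 2 ∂P
      = x j ^ 2 + y j ^ 2 + 2 * (x j * y j * ∫ ω, U j ω * V j ω ∂P) := by
    intro j
    have e : ∀ ω, Y j ω ^ 2
        = (x j ^ 2 * U j ω ^ 2 + y j ^ 2 * V j ω ^ 2) + 2 * (x j * y j) * (U j ω * V j ω) := by
      intro ω; simp only [hYdef]; ring
    have i1 := (hU.memLp_two j).integrable_sq.const_mul (x j ^ 2)
    have i2 := (hV.memLp_two j).integrable_sq.const_mul (y j ^ 2)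
    have i3 : Integrable (fun ω => 2 * (x j * y j) * (U j ω * V j ω)) P :=
      ((hU.memLp_two j).integrable_mul (hV.memLp_two j)).const_mul _
    have i12 : Integrable (fun ω => x j ^ 2 * U j ω ^ 2 + y j ^ 2 * V j ω ^ 2) P := i1.add i2
    simp_rw [e]
    rw [integral_add i12 i3, integral_add i1 i2, integral_const_mul, integral_const_mul,
      integral_const_mul, hU.sq_mean_eq, hV.sq_mean_eq]
    ring
  have hYsq_le : ∀ j, ∫ ω, Y j ω ^ 2 ∂P ≤ 2 * x j ^ 2 + 2 * y j ^ 2 := by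
    intro j
    have i1 := (hU.memLp_two j).integrable_sq.const_mul (2 * x j ^ 2)
    have i2 := (hV.memLp_two j).integrable_sq.const_mul (2 * y j ^ 2)
    calc ∫ ω, Y j ω ^ 2 ∂P
        ≤ ∫ ω, (2 * x j ^ 2 * U j ω ^ 2 + 2 * y j ^ 2 * V j ω ^ 2) ∂P := by
          refine integral_mono (hYL j).integrable_sq (i1.add i2) fun ω => ?_
          simp only [hYdef]
          nlinarith [sq_nonneg (x j * U j ω - y j * V j ω)]
      _ = _ := by
          rw [integral_add i1 i2, integral_const_mul, integral_const_mul, hU.sq_mean_eq,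
            hV.sq_mean_eq]
          ring
  have hYsum : ∀ ω, ∑ j ∈ Finset.range N, Y j ω
      = a * ((√n₁)⁻¹ * ∑ j ∈ Finset.range n₁, U j ω)
        + b * ((√n₂)⁻¹ * ∑ j ∈ Finset.range n₂, V j ω) := by
    intro ω
    simp only [hYdef, hx, hy, Finset.sum_add_distrib, ite_mul, zero_mul]
    rw [sum_range_ite_lt (le_max_left _ _), sum_range_ite_lt (le_max_right _ _),
      ← Finset.mul_sum, ← Finset.mul_sum]
    ring
  have hvar : ∑ j ∈ Finset.range N, ∫ ω, Y j ω ^ 2 ∂P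
      = a ^ 2 + b ^ 2 + 2 * a * b * (1 / √((n₁ : ℝ) * n₂) *
        ∑ j ∈ Finset.range (min n₁ n₂), ∫ ω, U j ω * V j ω ∂P) := by
    have e1 : ∀ j, x j ^ 2 = if j < n₁ then (a / √n₁) ^ 2 else 0 := by
      intro j; simp only [hx]; split_ifs <;> simp
    have e2 : ∀ j, y j ^ 2 = if j < n₂ then (b / √n₂) ^ 2 else 0 := by
      intro j; simp only [hy]; split_ifs <;> simp
    -- Both coefficients survive only below the minimum: this is where the range of summation in
    -- `rhoBar` comes from.
    have e3 : ∀ j, x j * y j * ∫ ω, U j ω * V j ω ∂P = if j < min n₁ n₂ then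
        (a / √n₁ * (b / √n₂)) * ∫ ω, U j ω * V j ω ∂P else 0 := by
      intro j
      simp only [hx, hy, lt_min_iff]
      by_cases k1 : j < n₁ <;> by_cases k2 : j < n₂ <;> simp [k1, k2]
    simp_rw [hYsq]
    rw [Finset.sum_add_distrib, Finset.sum_add_distrib, ← Finset.mul_sum]
    simp_rw [e1, e2, e3]
    rw [sum_range_ite_lt (le_max_left _ _), sum_range_ite_lt (le_max_right _ _),
      sum_range_ite_lt (min_le_max), ← Finset.mul_sum, Finset.sum_const, Finset.sum_const,
      Finset.card_range, Finset.card_range, nsmul_eq_mul, nsmul_eq_mul, div_pow, div_pow,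
      Real.sq_sqrt h₁'.le, Real.sq_sqrt h₂'.le, Real.sqrt_mul h₁'.le]
    field_simp
  have key := norm_integral_exp_sum_sub_gaussian_le hYm hYL hY0 hYind (Finset.range N)
  simp_rw [hYsum] at key
  rw [hvar] at key
  refine key.trans ?_
  -- Here `32 = 4 * 8` comes from `minSqCube_add_le`, and `8` from `(2x² + 2y²)² ≤ 8 (x⁴ + y⁴)`.
  have hA : ∀ j, 4 * ∫ ω, minSqCube (Y j ω) ∂P + (∫ ω, Y j ω ^ 2 ∂P) ^ 2
      ≤ 32 * (∫ ω, minSqCube (x j * U j ω) ∂P + ∫ ω, minSqCube (y j * V j ω) ∂P)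
        + 8 * (x j ^ 4 + y j ^ 4) := by
    intro j
    have i1 := integrable_minSqCube ((hU.measurable j).const_mul (x j)) (hxU j)
    have i2 := integrable_minSqCube ((hV.measurable j).const_mul (y j)) (hyV j)
    have b1 : ∫ ω, minSqCube (Y j ω) ∂P
        ≤ 8 * (∫ ω, minSqCube (x j * U j ω) ∂P + ∫ ω, minSqCube (y j * V j ω) ∂P) := by
      rw [← integral_add i1 i2, ← integral_const_mul]
      exact integral_mono (integrable_minSqCube (hYm j) (hYL j)) ((i1.add i2).const_mul 8)
        fun ω => minSqCube_add_le _ _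
    have b2 : (∫ ω, Y j ω ^ 2 ∂P) ^ 2 ≤ (2 * x j ^ 2 + 2 * y j ^ 2) ^ 2 :=
      pow_le_pow_left₀ (integral_nonneg fun ω => sq_nonneg _) (hYsq_le j) 2
    nlinarith [sq_nonneg (x j ^ 2 - y j ^ 2)]
  refine (Finset.sum_le_sum fun j _ => hA j).trans ?_
  rw [Finset.sum_add_distrib, ← Finset.mul_sum, ← Finset.mul_sum, Finset.sum_add_distrib,
    Finset.sum_add_distrib]
  gcongr
  · exact hU.sum_integral_minSqCube_le (le_max_left _ _) ha
  · exact hV.sum_integral_minSqCube_le (le_max_right _ _) hb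
  · exact sum_range_ite_pow_four_le h₁ (le_max_left _ _) ha
  · exact sum_range_ite_pow_four_le h₂ (le_max_right _ _) hb

end SampleMeans

/-! ### Asymptotics of characteristic functions of the sample means -/

namespace SampleMeans

variable {Ω : Type*} [MeasurableSpace Ω] {P : Measure Ω}

lemma standardizedMean_eq {Ω : Type*} (X : ℕ → Ω → ℝ) (m s : ℝ) (n : ℕ) (ω : Ω) :
    standardizedMean X m s n ω = (√n)⁻¹ * ∑ j ∈ Finset.range n, (X j ω - m) / s := by
  unfold standardizedMean sampleMean
  rw [← Finset.sum_div, Finset.sum_sub_distrib, Finset.sum_const, Finset.card_range, nsmul_eq_mul]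
  rcases n.eq_zero_or_pos with rfl | hn
  · simp
  · have hn' : (0 : ℝ) < n := by exact_mod_cast hn
    have hs : 0 < √(n : ℝ) := Real.sqrt_pos.2 hn'
    field_simp
    rw [Real.sq_sqrt hn'.le]

lemma IsIIDSeq.measurable_standardizedMean {X : ℕ → Ω → ℝ} {m s : ℝ} (h : IsIIDSeq P X m s)
    (n : ℕ) : Measurable (standardizedMean X m s n) := by
  have := h.measurable
  unfold standardizedMean sampleMean
  fun_prop

lemma correlation_eq_integral {X₁ X₂ : ℕ → Ω → ℝ} {m₁ m₂ s₁ s₂ : ℝ} (h₁ : IsIIDSeq P X₁ m₁ s₁)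
    (h₂ : IsIIDSeq P X₂ m₂ s₂) (j : ℕ) :
    correlation P (X₁ j) (X₂ j) = ∫ ω, (X₁ j ω - m₁) / s₁ * ((X₂ j ω - m₂) / s₂) ∂P := by
  unfold correlation covariance
  rw [h₁.variance_eq, h₂.variance_eq, Real.sqrt_sq h₁.sd_pos.le, Real.sqrt_sq h₂.sd_pos.le,
    h₁.mean_eq, h₂.mean_eq, ← integral_div]
  congr 1
  ext ω
  rw [div_mul_div_comm]

variable [IsProbabilityMeasure P]

lemma IsIIDSeq.isStandardSeq {X : ℕ → Ω → ℝ} {m s : ℝ} (h : IsIIDSeq P X m s) :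
    IsStandardSeq P (fun j ω => (X j ω - m) / s) where
  measurable j := ((h.measurable j).sub_const m).div_const s
  identDistrib j := (h.identDistrib j 0).comp (u := fun x => (x - m) / s) (by fun_prop)
  memLp_two j := by
    simp_rw [div_eq_inv_mul]
    exact ((h.memLp_two j).sub (memLp_const m)).const_mul _
  mean_eq j := by
    rw [integral_div, integral_sub ((h.memLp_two j).integrable (by norm_num)) (integrable_const m),
      h.mean_eq]
    simp
  sq_mean_eq j := by
    have hv := variance_eq_integral (μ := P) (h.measurable j).aemeasurable
    rw [h.mean_eq, h.variance_eq] at hv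
    simp_rw [div_pow]
    rw [integral_div, ← hv, div_self (pow_ne_zero 2 h.sd_pos.ne')]

/-- Asymptotics of the characteristic functions of bounded linear combinations of the two
standardized sample means. -/
lemma tendsto_integral_exp_standardizedMean_sub {X₁ X₂ : ℕ → Ω → ℝ} {m₁ m₂ s₁ s₂ : ℝ}
    (h₁ : IsIIDSeq P X₁ m₁ s₁) (h₂ : IsIIDSeq P X₂ m₂ s₂)
    (hpairs : iIndepFun (fun j ω => (X₁ j ω, X₂ j ω)) P) {a b : ℕ × ℕ → ℝ} {M : ℝ}
    (ha : ∀ α, |a α| ≤ M) (hb : ∀ α, |b α| ≤ M) :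
    Tendsto (fun α : ℕ × ℕ =>
      ∫ ω, Complex.exp ((a α * standardizedMean X₁ m₁ s₁ α.1 ω
        + b α * standardizedMean X₂ m₂ s₂ α.2 ω : ℝ) * Complex.I) ∂P
      - Real.exp (-((a α ^ 2 + b α ^ 2 + 2 * a α * b α * rhoBar P X₁ X₂ α) / 2)))
      atTop (𝓝 0) := by
  have hU := h₁.isStandardSeq
  have hV := h₂.isStandardSeq
  have hind : iIndepFun (fun j ω => ((X₁ j ω - m₁) / s₁, (X₂ j ω - m₂) / s₂)) P :=
    hpairs.comp (fun _ (p : ℝ × ℝ) => ((p.1 - m₁) / s₁, (p.2 - m₂) / s₂)) fun _ => by fun_prop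
  have hfst : Tendsto (fun α : ℕ × ℕ => α.1) atTop atTop := by
    rw [← prod_atTop_atTop_eq]; exact tendsto_fst
  have hsnd : Tendsto (fun α : ℕ × ℕ => α.2) atTop atTop := by
    rw [← prod_atTop_atTop_eq]; exact tendsto_snd
  have hrate : Tendsto (fun α : ℕ × ℕ =>
      32 * (lindebergRate P (fun ω => (X₁ 0 ω - m₁) / s₁) M α.1
        + lindebergRate P (fun ω => (X₂ 0 ω - m₂) / s₂) M α.2)
        + 8 * (M ^ 4 / (α.1 : ℝ) + M ^ 4 / (α.2 : ℝ))) atTop (𝓝 0) := by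
    have t1 := (tendsto_lindebergRate (hU.measurable 0) (hU.memLp_two 0) M).comp hfst
    have t2 := (tendsto_lindebergRate (hV.measurable 0) (hV.memLp_two 0) M).comp hsnd
    have t3 := (tendsto_const_div_atTop_nhds_zero_nat (M ^ 4)).comp hfst
    have t4 := (tendsto_const_div_atTop_nhds_zero_nat (M ^ 4)).comp hsnd
    simpa using ((t1.add t2).const_mul 32).add ((t3.add t4).const_mul 8)
  refine squeeze_zero_norm' ?_ hrate
  filter_upwards [hfst.eventually_gt_atTop 0, hsnd.eventually_gt_atTop 0] with α hα₁ hα₂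
  have := norm_integral_exp_sub_gaussian_pair_le hU hV hind hα₁ hα₂ (ha α) (hb α)
  simp_rw [← standardizedMean_eq, ← correlation_eq_integral h₁ h₂] at this
  exact this

lemma tendsto_integral_exp_standardizedMean {X₁ X₂ : ℕ → Ω → ℝ} {m₁ m₂ s₁ s₂ : ℝ}
    (h₁ : IsIIDSeq P X₁ m₁ s₁) (h₂ : IsIIDSeq P X₂ m₂ s₂)
    (hpairs : iIndepFun (fun j ω => (X₁ j ω, X₂ j ω)) P) {a b : ℕ × ℕ → ℝ} {M c : ℝ}
    (ha : ∀ α, |a α| ≤ M) (hb : ∀ α, |b α| ≤ M)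
    (hc : ∀ᶠ α in atTop, a α ^ 2 + b α ^ 2 = c)
    (hρ : Tendsto (fun α : ℕ × ℕ => rhoBar P X₁ X₂ α) atTop (𝓝 0)) :
    Tendsto (fun α : ℕ × ℕ =>
      ∫ ω, Complex.exp ((a α * standardizedMean X₁ m₁ s₁ α.1 ω
        + b α * standardizedMean X₂ m₂ s₂ α.2 ω : ℝ) * Complex.I) ∂P)
      atTop (𝓝 (Real.exp (-(c / 2)) : ℝ)) := by
  have hab : Tendsto (fun α => 2 * a α * b α * rhoBar P X₁ X₂ α) atTop (𝓝 0) := by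
    refine squeeze_zero_norm (a := fun α => 2 * M * M * |rhoBar P X₁ X₂ α|) (fun α => ?_) ?_
    · have hM : 0 ≤ M := (abs_nonneg _).trans (ha α)
      rw [Real.norm_eq_abs, abs_mul, abs_mul, abs_mul, abs_two]
      gcongr
      exacts [ha α, hb α]
    · simpa using hρ.abs.const_mul (2 * M * M)
  have hg : Tendsto (fun α => Real.exp
      (-((a α ^ 2 + b α ^ 2 + 2 * a α * b α * rhoBar P X₁ X₂ α) / 2))) atTop
      (𝓝 (Real.exp (-(c / 2)))) := by
    refine (Real.continuous_exp.tendsto _).comp ?_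
    have h0 : Tendsto (fun α => a α ^ 2 + b α ^ 2) atTop (𝓝 c) :=
      tendsto_const_nhds.congr' (hc.mono fun _ h => h.symm)
    simpa using ((h0.add hab).div_const 2).neg
  have := (tendsto_integral_exp_standardizedMean_sub h₁ h₂ hpairs ha hb).add
    ((Complex.continuous_ofReal.tendsto _).comp hg)
  simpa using this

/-- Along a countably generated filter, such as `atTop` on `ℕ × ℕ`, convergence can be tested on
sequences, where Lévy's continuity theorem applies. -/
lemma tendsto_of_tendsto_charFun_of_isCountablyGenerated {E ι : Type*} [NormedAddCommGroup E]
    [InnerProductSpace ℝ E] [FiniteDimensional ℝ E] [MeasurableSpace E] [BorelSpace E]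
    {l : Filter ι} [l.IsCountablyGenerated] {μ : ι → ProbabilityMeasure E}
    {μ₀ : ProbabilityMeasure E}
    (h : ∀ t : E, Tendsto (fun i => charFun (μ i) t) l (𝓝 (charFun μ₀ t))) :
    Tendsto μ l (𝓝 μ₀) :=
  tendsto_of_seq_tendsto fun _ hx =>
    ProbabilityMeasure.tendsto_of_tendsto_charFun fun t => (h t).comp hx

lemma tendsto_integral_exp_of_tendstoInDistribution {ι Ω' : Type*} [MeasurableSpace Ω']
    {Q : Measure Ω'} [IsProbabilityMeasure Q] {l : Filter ι} {Z : ι → Ω → ℝ} {Y : Ω' → ℝ}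
    (h : TendstoInDistribution Z l Y (fun _ => P) Q) :
    Tendsto (fun i => ∫ ω, Complex.exp (Z i ω * Complex.I) ∂P) l
      (𝓝 (∫ ω, Complex.exp (Y ω * Complex.I) ∂Q)) := by
  have h1 := (ProbabilityMeasure.tendsto_iff_forall_integral_rclike_tendsto ℂ).1 h.tendsto
    (BoundedContinuousFunction.innerProbChar (1 : ℝ))
  simp only [ProbabilityMeasure.coe_mk, BoundedContinuousFunction.innerProbChar_apply] at h1
  rw [integral_map h.aemeasurable_limit (by fun_prop)] at h1
  simp_rw [integral_map (h.forall_aemeasurable _)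
    (f := fun x : ℝ => Complex.exp (inner ℝ x 1 * Complex.I)) (by fun_prop)] at h1
  simpa using h1

lemma integral_exp_gaussianReal (t : ℝ) :
    ∫ x, Complex.exp ((t * x : ℝ) * Complex.I) ∂(gaussianReal 0 1)
      = (Real.exp (-(t ^ 2 / 2)) : ℝ) := by
  have := charFun_gaussianReal (μ := 0) (v := 1) t
  rw [charFun_apply_real] at this
  push_cast
  rw [this]
  congr 1
  simp

end SampleMeans

/-! ### Weights of the difference, reduction to the diagonal, and the implications -/

namespace SampleMeans

/-- The weight `x / √(x² + y²)` with `x = s / √n` and `y = s' / √n'`. -/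
noncomputable def diffWeight (s s' : ℝ) (n n' : ℕ) : ℝ :=
  s / √n / √(s ^ 2 / n + s' ^ 2 / n')

lemma abs_diffWeight_le_one (s s' : ℝ) (n n' : ℕ) : |diffWeight s s' n n'| ≤ 1 := by
  unfold diffWeight
  rw [abs_div, abs_of_nonneg (Real.sqrt_nonneg (s ^ 2 / n + s' ^ 2 / n'))]
  refine div_le_one_of_le₀ (Real.abs_le_sqrt ?_) (Real.sqrt_nonneg _)
  rw [div_pow, Real.sq_sqrt n.cast_nonneg]
  have : 0 ≤ s' ^ 2 / n' := by positivity
  linarith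

lemma diffWeight_sq_add_sq {s s' : ℝ} (hs : 0 < s) {n n' : ℕ} (hn : 0 < n) :
    diffWeight s s' n n' ^ 2 + diffWeight s' s n' n ^ 2 = 1 := by
  have hn' : (0 : ℝ) < n := by exact_mod_cast hn
  have hpos : 0 < s ^ 2 / n + s' ^ 2 / n' := by positivity
  unfold diffWeight
  rw [add_comm (s' ^ 2 / (n' : ℝ)), div_pow, div_pow, div_pow, div_pow, Real.sq_sqrt hpos.le,
    Real.sq_sqrt n.cast_nonneg, Real.sq_sqrt n'.cast_nonneg, ← add_div, div_self hpos.ne']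

lemma diffWeight_diag {s s' : ℝ} {k : ℕ} (hk : 0 < k) :
    diffWeight s s' k k = s / √(s ^ 2 + s' ^ 2) := by
  have hk' : (0 : ℝ) < k := by exact_mod_cast hk
  have : 0 < √(k : ℝ) := Real.sqrt_pos.2 hk'
  unfold diffWeight
  rw [← add_div, Real.sqrt_div' _ hk'.le]
  field_simp

lemma standardizedDiff_eq {Ω : Type*} (X₁ X₂ : ℕ → Ω → ℝ) (m₁ m₂ : ℝ) {s₁ s₂ : ℝ} (hs₁ : 0 < s₁)
    (hs₂ : 0 < s₂) {n₁ n₂ : ℕ} (hn₁ : 0 < n₁) (hn₂ : 0 < n₂) (ω : Ω) :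
    standardizedDiff X₁ X₂ m₁ m₂ s₁ s₂ n₁ n₂ ω
      = diffWeight s₁ s₂ n₁ n₂ * standardizedMean X₁ m₁ s₁ n₁ ω
        + -diffWeight s₂ s₁ n₂ n₁ * standardizedMean X₂ m₂ s₂ n₂ ω := by
  have h₁ : 0 < √(n₁ : ℝ) := Real.sqrt_pos.2 (by exact_mod_cast hn₁)
  have h₂ : 0 < √(n₂ : ℝ) := Real.sqrt_pos.2 (by exact_mod_cast hn₂)
  unfold standardizedDiff standardizedMean diffWeight
  rw [add_comm (s₂ ^ 2 / (n₂ : ℝ))]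
  have e₁ : ∀ D x : ℝ, s₁ / √(n₁ : ℝ) / D * (√(n₁ : ℝ) * x / s₁) = x / D := by
    intro D x; field_simp
  have e₂ : ∀ D x : ℝ, s₂ / √(n₂ : ℝ) / D * (√(n₂ : ℝ) * x / s₂) = x / D := by
    intro D x; field_simp
  rw [neg_mul, e₁, e₂]
  ring

lemma tendsto_of_tendsto_ofReal_exp {ι : Type*} {l : Filter ι} {f : ι → ℝ} {c : ℝ}
    (h : Tendsto (fun i => ((Real.exp (f i) : ℝ) : ℂ)) l (𝓝 (Real.exp c : ℝ))) :
    Tendsto f l (𝓝 c) := by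
  have h1 := (Complex.continuous_re.tendsto _).comp h
  simp only [Function.comp_def, Complex.ofReal_re] at h1
  simpa using h1.log (Real.exp_pos c).ne'

lemma eventually_fst_snd_pos : ∀ᶠ α : ℕ × ℕ in atTop, 0 < α.1 ∧ 0 < α.2 :=
  (eventually_ge_atTop ((1, 1) : ℕ × ℕ)).mono fun _ h => ⟨h.1, h.2⟩

lemma tendsto_diag : Tendsto (fun k : ℕ => (k, k)) atTop (atTop : Filter (ℕ × ℕ)) := by
  rw [← prod_atTop_atTop_eq]; exact tendsto_id.prodMk tendsto_id

variable {Ω : Type*} [MeasurableSpace Ω] {P : Measure Ω}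

/-- Both sides contain the same sum, and `√(n₁ n₂)` is at least the minimum. -/
lemma abs_rhoBar_le (X₁ X₂ : ℕ → Ω → ℝ) (α : ℕ × ℕ) :
    |rhoBar P X₁ X₂ α| ≤ |rhoBar P X₁ X₂ (min α.1 α.2, min α.1 α.2)| := by
  unfold rhoBar
  simp only [min_self]
  rw [abs_mul, abs_mul]
  rcases (min α.1 α.2).eq_zero_or_pos with h | h
  · simp [h]
  · have h' : (0 : ℝ) < (min α.1 α.2 : ℕ) := by exact_mod_cast h
    have l₁ : ((min α.1 α.2 : ℕ) : ℝ) ≤ α.1 := by exact_mod_cast min_le_left _ _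
    have l₂ : ((min α.1 α.2 : ℕ) : ℝ) ≤ α.2 := by exact_mod_cast min_le_right _ _
    refine mul_le_mul_of_nonneg_right ?_ (abs_nonneg _)
    rw [abs_of_nonneg (by positivity), abs_of_nonneg (by positivity)]
    refine one_div_le_one_div_of_le (Real.sqrt_pos.2 (by positivity)) (Real.sqrt_le_sqrt ?_)
    exact mul_le_mul l₁ l₂ h'.le (h'.le.trans l₁)

lemma tendsto_rhoBar_of_diag {X₁ X₂ : ℕ → Ω → ℝ}
    (h : Tendsto (fun k : ℕ => rhoBar P X₁ X₂ (k, k)) atTop (𝓝 0)) :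
    Tendsto (fun α : ℕ × ℕ => rhoBar P X₁ X₂ α) atTop (𝓝 0) := by
  have hmin : Tendsto (fun α : ℕ × ℕ => min α.1 α.2) atTop atTop :=
    tendsto_atTop.2 fun b => (eventually_ge_atTop ((b, b) : ℕ × ℕ)).mono fun _ h => le_min h.1 h.2
  refine squeeze_zero_norm (fun α => abs_rhoBar_le X₁ X₂ α) ?_
  simpa using (h.comp hmin).abs

variable [IsProbabilityMeasure P]
  {X₁ X₂ : ℕ → Ω → ℝ} {m₁ m₂ s₁ s₂ : ℝ}

lemma tendstoInDistribution_standardizedMean (h₁ : IsIIDSeq P X₁ m₁ s₁)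
    (h₂ : IsIIDSeq P X₂ m₂ s₂) (hpairs : iIndepFun (fun j ω => (X₁ j ω, X₂ j ω)) P)
    (hρ : Tendsto (fun α : ℕ × ℕ => rhoBar P X₁ X₂ α) atTop (𝓝 0)) :
    TendstoInDistribution
      (fun (α : ℕ × ℕ) (ω : Ω) =>
        (standardizedMean X₁ m₁ s₁ α.1 ω, standardizedMean X₂ m₂ s₂ α.2 ω))
      atTop (id : ℝ × ℝ → ℝ × ℝ) (fun _ => P) ((gaussianReal 0 1).prod (gaussianReal 0 1)) := by
  -- Characteristic functions are taken on an inner product space, hence the passage to `WithLp 2`;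
  -- the continuous map `ofLp` brings the convergence back.
  have hmeas : ∀ α : ℕ × ℕ, Measurable (fun ω => WithLp.toLp 2
      (standardizedMean X₁ m₁ s₁ α.1 ω, standardizedMean X₂ m₂ s₂ α.2 ω)) := fun α =>
    (WithLp.measurable_toLp 2 _).comp
      ((h₁.measurable_standardizedMean α.1).prodMk (h₂.measurable_standardizedMean α.2))
  have hL : TendstoInDistribution
      (fun (α : ℕ × ℕ) (ω : Ω) => WithLp.toLp 2
        (standardizedMean X₁ m₁ s₁ α.1 ω, standardizedMean X₂ m₂ s₂ α.2 ω))
      atTop (WithLp.toLp 2 : ℝ × ℝ → WithLp 2 (ℝ × ℝ)) (fun _ => P)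
      ((gaussianReal 0 1).prod (gaussianReal 0 1)) := by
    refine ⟨fun α => (hmeas α).aemeasurable, (WithLp.measurable_toLp 2 _).aemeasurable, ?_⟩
    refine tendsto_of_tendsto_charFun_of_isCountablyGenerated fun t => ?_
    simp only [ProbabilityMeasure.coe_mk]
    rw [charFun_prod, charFun_gaussianReal, charFun_gaussianReal]
    have key := tendsto_integral_exp_standardizedMean h₁ h₂ hpairs (a := fun _ => t.ofLp.1)
      (b := fun _ => t.ofLp.2) (M := max |t.ofLp.1| |t.ofLp.2|) (fun _ => le_max_left _ _)
      (fun _ => le_max_right _ _) (Eventually.of_forall fun _ => rfl) hρ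
    convert! key using 2 with α
    · rw [charFun_apply, integral_map (hmeas α).aemeasurable (by fun_prop)]
      simp [WithLp.prod_inner_apply]
    · rw [← Complex.exp_add]
      push_cast
      congr 1
      simp
      ring
  exact hL.continuous_comp (g := WithLp.ofLp) (WithLp.prod_continuous_ofLp 2 ℝ ℝ)

lemma tendsto_rhoBar_of_tendstoInDistribution_standardizedMean (h₁ : IsIIDSeq P X₁ m₁ s₁)
    (h₂ : IsIIDSeq P X₂ m₂ s₂) (hpairs : iIndepFun (fun j ω => (X₁ j ω, X₂ j ω)) P)
    (h : TendstoInDistribution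
      (fun (α : ℕ × ℕ) (ω : Ω) =>
        (standardizedMean X₁ m₁ s₁ α.1 ω, standardizedMean X₂ m₂ s₂ α.2 ω))
      atTop (id : ℝ × ℝ → ℝ × ℝ) (fun _ => P) ((gaussianReal 0 1).prod (gaussianReal 0 1))) :
    Tendsto (fun α : ℕ × ℕ => rhoBar P X₁ X₂ α) atTop (𝓝 0) := by
  have hsum := tendsto_integral_exp_of_tendstoInDistribution
    (h.continuous_comp (g := fun p : ℝ × ℝ => p.1 + p.2) (by fun_prop))
  have hlim : ∫ p : ℝ × ℝ, Complex.exp ((p.1 + p.2 : ℝ) * Complex.I)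
      ∂((gaussianReal 0 1).prod (gaussianReal 0 1)) = (Real.exp (-1) : ℝ) := by
    have e : ∀ p : ℝ × ℝ, Complex.exp ((p.1 + p.2 : ℝ) * Complex.I)
        = Complex.exp ((1 * p.1 : ℝ) * Complex.I) * Complex.exp ((1 * p.2 : ℝ) * Complex.I) := by
      intro p
      rw [← Complex.exp_add]; push_cast; congr 1; ring
    simp_rw [e]
    rw [integral_prod_mul (fun x : ℝ => Complex.exp ((1 * x : ℝ) * Complex.I))
      (fun x : ℝ => Complex.exp ((1 * x : ℝ) * Complex.I)), integral_exp_gaussianReal,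
      ← Complex.ofReal_mul, ← Real.exp_add]
    norm_num
  -- With `a = b = 1` the Gaussian exponent is `-(1 + rhoBar)`, to be compared with the limit `-1`.
  have hdiff := tendsto_integral_exp_standardizedMean_sub h₁ h₂ hpairs (a := fun _ => 1)
    (b := fun _ => 1) (M := 1) (by simp) (by simp)
  simp only [Function.comp_def, id] at hsum
  rw [hlim] at hsum
  simp only [one_mul] at hdiff
  have hexp := hsum.sub hdiff
  simp only [sub_sub_cancel, sub_zero] at hexp
  have := ((tendsto_of_tendsto_ofReal_exp hexp).add_const 1).neg
  simp only [neg_add_cancel, neg_zero] at this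
  refine this.congr fun α => ?_
  ring

lemma tendstoInDistribution_standardizedDiff (h₁ : IsIIDSeq P X₁ m₁ s₁)
    (h₂ : IsIIDSeq P X₂ m₂ s₂) (hpairs : iIndepFun (fun j ω => (X₁ j ω, X₂ j ω)) P)
    (hρ : Tendsto (fun α : ℕ × ℕ => rhoBar P X₁ X₂ α) atTop (𝓝 0)) :
    TendstoInDistribution
      (fun (α : ℕ × ℕ) (ω : Ω) => standardizedDiff X₁ X₂ m₁ m₂ s₁ s₂ α.1 α.2 ω)
      atTop (id : ℝ → ℝ) (fun _ => P) (gaussianReal 0 1) := by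
  have hmeas : ∀ α : ℕ × ℕ, Measurable (fun ω => standardizedDiff X₁ X₂ m₁ m₂ s₁ s₂ α.1 α.2 ω) := by
    intro α
    have := h₁.measurable
    have := h₂.measurable
    unfold standardizedDiff sampleMean
    fun_prop
  refine ⟨fun α => (hmeas α).aemeasurable, aemeasurable_id, ?_⟩
  refine tendsto_of_tendsto_charFun_of_isCountablyGenerated fun t => ?_
  simp only [ProbabilityMeasure.coe_mk, Measure.map_id]
  have key := tendsto_integral_exp_standardizedMean h₁ h₂ hpairs
    (a := fun α => t * diffWeight s₁ s₂ α.1 α.2) (b := fun α => t * -diffWeight s₂ s₁ α.2 α.1)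
    (M := |t|) (c := t ^ 2)
    (fun α => by
      rw [abs_mul]
      exact mul_le_of_le_one_right (abs_nonneg t) (abs_diffWeight_le_one _ _ _ _))
    (fun α => by
      rw [abs_mul, abs_neg]
      exact mul_le_of_le_one_right (abs_nonneg t) (abs_diffWeight_le_one _ _ _ _))
    (eventually_fst_snd_pos.mono fun α hα => by
      linear_combination t ^ 2 * diffWeight_sq_add_sq (s' := s₂) (n' := α.2) h₁.sd_pos hα.1) hρ
  have hlim : charFun (gaussianReal 0 1) t = (Real.exp (-(t ^ 2 / 2)) : ℝ) := by
    rw [← integral_exp_gaussianReal, charFun_apply_real]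
    simp
  rw [hlim]
  refine key.congr' (eventually_fst_snd_pos.mono fun α hα => ?_)
  simp only
  rw [charFun_apply_real, integral_map (hmeas α).aemeasurable (by fun_prop)]
  congr 1
  ext ω
  rw [standardizedDiff_eq X₁ X₂ m₁ m₂ h₁.sd_pos h₂.sd_pos hα.1 hα.2]
  push_cast
  congr 1
  ring

lemma tendsto_rhoBar_diag_of_tendstoInDistribution_standardizedDiff (h₁ : IsIIDSeq P X₁ m₁ s₁)
    (h₂ : IsIIDSeq P X₂ m₂ s₂) (hpairs : iIndepFun (fun j ω => (X₁ j ω, X₂ j ω)) P)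
    (h : TendstoInDistribution
      (fun (α : ℕ × ℕ) (ω : Ω) => standardizedDiff X₁ X₂ m₁ m₂ s₁ s₂ α.1 α.2 ω)
      atTop (id : ℝ → ℝ) (fun _ => P) (gaussianReal 0 1)) :
    Tendsto (fun k : ℕ => rhoBar P X₁ X₂ (k, k)) atTop (𝓝 0) := by
  have hint := tendsto_integral_exp_of_tendstoInDistribution h
  have hlim : ∫ x : ℝ, Complex.exp ((id x : ℝ) * Complex.I) ∂(gaussianReal 0 1)
      = (Real.exp (-(1 / 2)) : ℝ) := by
    simpa using integral_exp_gaussianReal 1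
  rw [hlim] at hint
  have hdiff := tendsto_integral_exp_standardizedMean_sub h₁ h₂ hpairs
    (a := fun α => diffWeight s₁ s₂ α.1 α.2) (b := fun α => -diffWeight s₂ s₁ α.2 α.1) (M := 1)
    (fun α => abs_diffWeight_le_one _ _ _ _)
    (fun α => by rw [abs_neg]; exact abs_diffWeight_le_one _ _ _ _)
  have hexp := (hint.sub hdiff).comp tendsto_diag
  have hD : 0 < √(s₁ ^ 2 + s₂ ^ 2) := Real.sqrt_pos.2 (by have := h₁.sd_pos; positivity)
  have hD' : 0 < √(s₂ ^ 2 + s₁ ^ 2) := Real.sqrt_pos.2 (by have := h₁.sd_pos; positivity)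
  -- On the diagonal the weights do not depend on `k`, and `w` is minus their signed product. The
  -- exponent is then `-1/2 + w * rhoBar`, and `w ≠ 0` allows solving for `rhoBar`.
  set w := s₁ / √(s₁ ^ 2 + s₂ ^ 2) * (s₂ / √(s₂ ^ 2 + s₁ ^ 2)) with hw
  have hw0 : w ≠ 0 := (mul_pos (div_pos h₁.sd_pos hD) (div_pos h₂.sd_pos hD')).ne'
  have hexp' : Tendsto (fun k : ℕ =>
      ((Real.exp (-(1 / 2) + w * rhoBar P X₁ X₂ (k, k)) : ℝ) : ℂ)) atTop
      (𝓝 (Real.exp (-(1 / 2)) : ℝ)) := by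
    rw [sub_zero] at hexp
    refine hexp.congr' ((eventually_gt_atTop 0).mono fun k hk => ?_)
    simp only [Function.comp_def]
    simp_rw [standardizedDiff_eq X₁ X₂ m₁ m₂ h₁.sd_pos h₂.sd_pos hk hk]
    rw [sub_sub_cancel]
    congr 2
    rw [hw, ← diffWeight_diag hk, ← diffWeight_diag hk]
    linear_combination (-1 / 2) * diffWeight_sq_add_sq (s' := s₂) (n' := k) h₁.sd_pos hk
  have := (((tendsto_of_tendsto_ofReal_exp hexp').add_const (1 / 2)).const_mul w⁻¹)
  simp only [neg_add_cancel, mul_zero] at this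
  refine this.congr fun k => ?_
  field_simp
  ring

end SampleMeans

theorem theorem1 {Ω : Type*} [MeasurableSpace Ω] (P : Measure Ω) [IsProbabilityMeasure P]
    (X₁ X₂ : ℕ → Ω → ℝ) (m₁ m₂ s₁ s₂ : ℝ)
    (h₁ : SampleMeans.IsIIDSeq P X₁ m₁ s₁)
    (h₂ : SampleMeans.IsIIDSeq P X₂ m₂ s₂)
    (hpairs : iIndepFun (fun (j : ℕ) (ω : Ω) => (X₁ j ω, X₂ j ω)) P) :
    List.TFAE [
      Tendsto (fun α : ℕ × ℕ => SampleMeans.rhoBar P X₁ X₂ α) atTop (𝓝 0),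
      Tendsto (fun k : ℕ => SampleMeans.rhoBar P X₁ X₂ (k, k)) atTop (𝓝 0),
      TendstoInDistribution
        (fun (α : ℕ × ℕ) (ω : Ω) =>
          (SampleMeans.standardizedMean X₁ m₁ s₁ α.1 ω,
            SampleMeans.standardizedMean X₂ m₂ s₂ α.2 ω))
        atTop (id : ℝ × ℝ → ℝ × ℝ) (fun _ => P)
        ((gaussianReal 0 1).prod (gaussianReal 0 1)),
      TendstoInDistribution
        (fun (α : ℕ × ℕ) (ω : Ω) =>
          SampleMeans.standardizedDiff X₁ X₂ m₁ m₂ s₁ s₂ α.1 α.2 ω)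
        atTop (id : ℝ → ℝ) (fun _ => P) (gaussianReal 0 1)] := by
  tfae_have 1 → 2 := fun h => h.comp SampleMeans.tendsto_diag
  tfae_have 2 → 1 := SampleMeans.tendsto_rhoBar_of_diag
  tfae_have 1 → 3 := SampleMeans.tendstoInDistribution_standardizedMean h₁ h₂ hpairs
  tfae_have 3 → 1 :=
    SampleMeans.tendsto_rhoBar_of_tendstoInDistribution_standardizedMean h₁ h₂ hpairs
  tfae_have 1 → 4 := SampleMeans.tendstoInDistribution_standardizedDiff h₁ h₂ hpairs
  tfae_have 4 → 2 :=
    SampleMeans.tendsto_rhoBar_diag_of_tendstoInDistribution_standardizedDiff h₁ h₂ hpairs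
  tfae_finish
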